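/- Let $p\ge 0$, $\boldsymbol\mu\in\mathbb R^{p+1}$ and $\boldsymbol\Lambda\in\mathbb R^{(p+1)\times(p+1)}$. Let $\mathcal C$ be the set of all probability distributions $\mathbb P$ of pairs $(\mathbf X,Y)$, with $\mathbf X=(X_1,\dots,X_p)$ in $\mathbb R^p$ and $Y$ in $\mathbb R$, that have finite second moments, $\mathbb E_{\mathbb P}[(\mathbf X\;\,Y)]=\boldsymbol\mu$ and $\mathbb E_{\mathbb P}[(\mathbf X\;\,Y)^T(\mathbf X\;\,Y)]=\boldsymbol\Lambda$, where $(\mathbf X\;\,Y)$ is a row vector; assume that $\mathcal C$ is non-empty. The Hirschfeld–Gebelein–Rényi maximal correlation coefficient is $$\rho_m(\mathbf X,Y)=\sup_{f,g}\mathbb E[f(\mathbf X)g(Y)],$$ the supremum being over all measurable $f:\mathbb R^p\to\mathbb R$ and $g:\mathbb R\to\mathbb R$ with $\mathbb E[f(\mathbf X)]=\mathbb E[g(Y)]=0$ and $\mathbb E[f^2(\mathbf X)]=\mathbb E[g^2(Y)]=1$; it is $0$ by convention if there are no such pairs $(f,g)$. Then $\mathcal C$ contains exactly one (possibly degenerate)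 Gaussian distribution $\mathbb P^G$, and $\mathbb P^G$ minimizes $\rho_m(\mathbf X,Y)$ over $\mathcal C$. Moreover, there is a vector $\mathbf a\in\mathbb R^p$ such that, under every distribution in $\mathcal C$, the residual $Y-\mathbf a^T\mathbf X$ is uncorrelated with each of $X_1,\dots,X_p$. Finally, if $\mathrm{Var}(Y)>0$, then for every $\mathbb P\in\mathcal C$ and every vector $\mathbf a$ for which $Y-\mathbf a^T\mathbf X$ is uncorrelated with $X_1,\dots,X_p$ under $\mathbb P$, the minimum value, attained by $\mathbb P^G$, is $$\sqrt{\frac{\mathrm{Var}_{\mathbb P}(\mathbf a^T\mathbf X)}{\mathrm{Var}_{\mathbb P}(Y)}}.$$ -/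

import Mathlib

open MeasureTheory ProbabilityTheory

noncomputable section

/-- The values `𝔼[f(X) g(Y)]` over all measurable `f`, `g` with `𝔼[f(X)] = 𝔼[g(Y)] = 0` and
`𝔼[f(X)²] = 𝔼[g(Y)²] = 1`, where `(X, Y)` has law `P`. A real integral that is equal to `1` is the
integral of an integrable function, so all such `f(X)`, `g(Y)` are square integrable. -/
def hgrValues {α β : Type*} [MeasurableSpace α] [MeasurableSpace β] (P : Measure (α × β)) :
    Set ℝ :=
  {r | ∃ (f : α → ℝ) (g : β → ℝ), Measurable f ∧ Measurable g ∧
    ∫ z, f z.1 ∂P = 0 ∧ ∫ z, g z.2 ∂P = 0 ∧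
    ∫ z, f z.1 ^ 2 ∂P = 1 ∧ ∫ z, g z.2 ^ 2 ∂P = 1 ∧
    r = ∫ z, f z.1 * g z.2 ∂P}

/-- The supremum that defines the maximal correlation is over a set bounded by `1`. -/
theorem le_one_of_mem_hgrValues {α β : Type*} [MeasurableSpace α] [MeasurableSpace β]
    (P : Measure (α × β)) {r : ℝ} (hr : r ∈ hgrValues P) : r ≤ 1 := by
  obtain ⟨f, g, hf, hg, -, -, hf2, hg2, rfl⟩ := hr
  have hfi : Integrable (fun z : α × β => f z.1 ^ 2) P := by
    by_contra h
    rw [integral_undef h] at hf2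
    exact zero_ne_one hf2
  have hgi : Integrable (fun z : α × β => g z.2 ^ 2) P := by
    by_contra h
    rw [integral_undef h] at hg2
    exact zero_ne_one hg2
  have hfL : MemLp (fun z : α × β => f z.1) 2 P :=
    (memLp_two_iff_integrable_sq (hf.comp measurable_fst).aestronglyMeasurable).2 hfi
  have hgL : MemLp (fun z : α × β => g z.2) 2 P :=
    (memLp_two_iff_integrable_sq (hg.comp measurable_snd).aestronglyMeasurable).2 hgi
  have h : ∫ z, f z.1 * g z.2 ∂P ≤ ∫ z, (f z.1 ^ 2 + g z.2 ^ 2) / 2 ∂P := by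
    refine integral_mono (hfL.integrable_mul hgL) ((hfi.add hgi).div_const 2) fun z => ?_
    have := sq_nonneg (f z.1 - g z.2)
    simp only
    linarith
  rw [integral_div, integral_add hfi hgi, hf2, hg2] at h
  linarith

/-- The Hirschfeld-Gebelein-Rényi maximal correlation `ρₘ(X, Y)` of a pair with law `P`. The set
of values is empty exactly when there is no admissible `f` or no admissible `g`; then the
coefficient is `0`, the usual convention. -/
def hgrCorrelation {α β : Type*} [MeasurableSpace α] [MeasurableSpace β] (P : Measure (α × β)) :
    ℝ :=
  sSup (hgrValues P)

/-- The vector `(X₁, …, X_p, Y)` of length `p + 1`. -/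
def jointVector {p : ℕ} (z : (Fin p → ℝ) × ℝ) : Fin (p + 1) → ℝ :=
  Fin.snoc (α := fun _ => ℝ) z.1 z.2

/-- `P` is a probability distribution of `(X, Y) ∈ ℝᵖ × ℝ` with finite second moments, mean vector
`μ = 𝔼[(X, Y)]` and (non-centred) second moment matrix `Λ = 𝔼[(X, Y)ᵀ (X, Y)]`. -/
structure HasMoments {p : ℕ} (μ : Fin (p + 1) → ℝ) (Λ : Matrix (Fin (p + 1)) (Fin (p + 1)) ℝ)
    (P : Measure ((Fin p → ℝ) × ℝ)) : Prop where
  isProbabilityMeasure : IsProbabilityMeasure P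
  memLp_two : ∀ i, MemLp (fun z => jointVector z i) 2 P
  first_moment : ∀ i, ∫ z, jointVector z i ∂P = μ i
  second_moment : ∀ i j, ∫ z, jointVector z i * jointVector z j ∂P = Λ i j

/-- `a` is a coefficient vector of the linear regression of `Y` on `X` (with intercept) under `P`:
the residual `Y - aᵀX` is uncorrelated with every coordinate of `X`. -/
def IsRegressionVector {p : ℕ} (P : Measure ((Fin p → ℝ) × ℝ)) (a : Fin p → ℝ) : Prop :=
  ∀ i : Fin p, cov[fun z : (Fin p → ℝ) × ℝ => z.2 - a ⬝ᵥ z.1, fun z => z.1 i; P] = 0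

end

/-! Let `a` be a regression vector of `Y` on `X`, put `U = aᵀX` and `ε = Y - U`, and let
`θ = Var(U) / Var(Y)`. The regression property gives `Cov(U, Y) = Var(U)`, so `U` and `Y` have
correlation `√θ`, and `√θ` is a lower bound of the maximal correlation under every distribution with
the given moments (`IsRegressionVector.sqrt_le_hgrCorrelation`). It depends only on the moments.

For a Gaussian pair `√θ` is also an upper bound. There `ε` is independent of `X`, so for an
exponential sum `g` the conditional expectation of `g(Y)` given `X` is an explicit exponential sum
in `U`. In terms of the normalized coefficients `c i` and the exponents `t i`, the squared norms of
`g(Y)` and of this projection are `∑ i j, c i * c j * exp (w * (t i * t j))` at `w = Var(Y)` and at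
`w = θ * Var(Y)`. As a function of `w` this is the power series with the coefficients
`(∑ i, c i * t i ^ n) ^ 2 / n!`, which are nonnegative. It is therefore convex on `[0, ∞)`, and its
value at `0` is the square of the mean: the projection contracts variances by the factor `θ`
(`gram_exp_le`). Exponentials span a dense subspace of `L²` of a Gaussian distribution
(`topologicalClosure_span_exp_eq_top`), which gives Gebelein's inequality
`𝔼[f(X) g(Y)]² ≤ θ 𝔼[f(X)²] Var(g(Y))` for all centred `f(X)`
(`sq_integral_mul_le_of_indepFun_gaussianReal`).

Degenerate cases need no separate treatment: if `Var(Y) = 0`, then `Var(U) = 0` and `θ = 0 / 0 = 0`,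
in accordance with the convention for the maximal correlation. -/

/-! ### Gram sums of exponentials -/

theorem hasSum_gram_exp {ι : Type*} (s : Finset ι) (c t : ι → ℝ) (w : ℝ) :
    HasSum (fun n : ℕ => w ^ n / n.factorial * (∑ i ∈ s, c i * t i ^ n) ^ 2)
      (∑ i ∈ s, ∑ j ∈ s, c i * c j * Real.exp (w * (t i * t j))) := by
  have h := hasSum_sum (s := s) fun i _ => hasSum_sum (s := s) fun j _ =>
    (NormedSpace.expSeries_div_hasSum_exp (w * (t i * t j))).mul_left (c i * c j)
  simp only [← Real.exp_eq_exp_ℝ] at h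
  suffices e : ∀ n : ℕ, w ^ n / n.factorial * (∑ i ∈ s, c i * t i ^ n) ^ 2 =
      ∑ i ∈ s, ∑ j ∈ s, c i * c j * ((w * (t i * t j)) ^ n / n.factorial) by
    simpa only [e] using h
  intro n
  rw [sq, Finset.sum_mul_sum, Finset.mul_sum]
  refine Finset.sum_congr rfl fun i _ => ?_
  rw [Finset.mul_sum]
  refine Finset.sum_congr rfl fun j _ => ?_
  rw [mul_pow, mul_pow]
  ring

/-- The Gram sum is a power series in `w` with nonnegative coefficients, hence convex on `[0, ∞)`:
this compares its values at `0`, `θ v` and `v`. -/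
theorem gram_exp_le {ι : Type*} (s : Finset ι) (c t : ι → ℝ) {θ v : ℝ} (hθ₀ : 0 ≤ θ) (hθ₁ : θ ≤ 1)
    (hv : 0 ≤ v) :
    ∑ i ∈ s, ∑ j ∈ s, c i * c j * Real.exp (θ * v * (t i * t j)) ≤
      θ * ∑ i ∈ s, ∑ j ∈ s, c i * c j * Real.exp (v * (t i * t j)) +
        (1 - θ) * (∑ i ∈ s, c i) ^ 2 := by
  have h₀ := hasSum_gram_exp s c t 0
  have e : ∑ i ∈ s, ∑ j ∈ s, c i * c j * Real.exp (0 * (t i * t j)) = (∑ i ∈ s, c i) ^ 2 := by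
    simp [sq, Finset.sum_mul_sum]
  rw [e] at h₀
  refine hasSum_le (fun n => ?_) (hasSum_gram_exp s c t (θ * v))
    (((hasSum_gram_exp s c t v).mul_left θ).add (h₀.mul_left (1 - θ)))
  have key : (θ * v) ^ n ≤ θ * v ^ n + (1 - θ) * 0 ^ n := by
    rcases n.eq_zero_or_pos with rfl | hn
    · simp
    · rw [mul_pow, zero_pow hn.ne', mul_zero, add_zero]
      exact mul_le_mul_of_nonneg_right (pow_le_of_le_one hθ₀ hθ₁ hn.ne') (pow_nonneg hv n)
  have := mul_le_mul_of_nonneg_right key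
    (show 0 ≤ (∑ i ∈ s, c i * t i ^ n) ^ 2 / n.factorial by positivity)
  calc _ = _ := by ring
    _ ≤ _ := this
    _ = _ := by ring

/-! ### Density of exponentials -/

theorem memLp_two_exp_mul {Ω : Type*} [MeasurableSpace Ω] {P : Measure Ω} {Y : Ω → ℝ}
    (hY : AEMeasurable Y P) {t : ℝ} (h : Integrable (fun ω => Real.exp (2 * t * Y ω)) P) :
    MemLp (fun ω => Real.exp (t * Y ω)) 2 P := by
  refine (memLp_two_iff_integrable_sq (by fun_prop)).2 ?_
  convert h using 2 with ω
  rw [← Real.exp_nat_mul]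
  push_cast
  ring_nf

/-- The positive and negative parts of `h` are densities of two finite measures with the same moment
generating function, which is finite everywhere and hence determines the measure. -/
theorem ae_eq_zero_of_integral_exp_mul_eq_zero {ν : Measure ℝ} [IsFiniteMeasure ν]
    (hν : ∀ t, Integrable (fun x => Real.exp (t * x)) ν) {h : ℝ → ℝ} (hh : MemLp h 2 ν)
    (h0 : ∀ t, ∫ x, Real.exp (t * x) * h x ∂ν = 0) : h =ᵐ[ν] 0 := by
  have hhi : Integrable h ν := hh.integrable (by norm_num)
  have hL (t : ℝ) := memLp_two_exp_mul (t := t) aemeasurable_id (hν (2 * t))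
  have hm1 : AEMeasurable (fun x => ENNReal.ofReal (h x)) ν :=
    hh.aestronglyMeasurable.aemeasurable.ennreal_ofReal
  have hm2 : AEMeasurable (fun x => ENNReal.ofReal (-h x)) ν :=
    hh.aestronglyMeasurable.aemeasurable.neg.ennreal_ofReal
  have hi1 (t : ℝ) : Integrable (fun x => max (h x) 0 * Real.exp (t * x)) ν :=
    hh.pos_part.integrable_mul (hL t)
  have hi2 (t : ℝ) : Integrable (fun x => max (-h x) 0 * Real.exp (t * x)) ν :=
    hh.neg_part.integrable_mul (hL t)
  set μ₁ := ν.withDensity (fun x => ENNReal.ofReal (h x)) with hμ₁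
  set μ₂ := ν.withDensity (fun x => ENNReal.ofReal (-h x)) with hμ₂
  have f1 : IsFiniteMeasure μ₁ := isFiniteMeasure_withDensity_ofReal hhi.2
  have f2 : IsFiniteMeasure μ₂ := isFiniteMeasure_withDensity_ofReal hhi.neg.2
  have g1 (t : ℝ) : mgf id μ₁ t = ∫ x, max (h x) 0 * Real.exp (t * x) ∂ν := by
    rw [mgf, hμ₁, integral_withDensity_eq_integral_toReal_smul₀ hm1 (by simp)]
    simp [ENNReal.toReal_ofReal']
  have g2 (t : ℝ) : mgf id μ₂ t = ∫ x, max (-h x) 0 * Real.exp (t * x) ∂ν := by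
    rw [mgf, hμ₂, integral_withDensity_eq_integral_toReal_smul₀ hm2 (by simp)]
    simp [ENNReal.toReal_ofReal']
  have hmgf : mgf id μ₁ = mgf id μ₂ := by
    ext t
    rw [g1, g2, ← sub_eq_zero, ← integral_sub (hi1 t) (hi2 t)]
    refine (integral_congr_ae ?_).trans (h0 t)
    refine .of_forall fun x => ?_
    have : max (h x) 0 - max (-h x) 0 = h x := by
      rcases le_total (h x) 0 with h' | h' <;> simp [h']
    simp only
    rw [← sub_mul, this, mul_comm]
  have hz : μ₁ = 0 ↔ μ₂ = 0 := by
    have := congrFun hmgf 0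
    rw [mgf_zero', mgf_zero'] at this
    rw [← Measure.measure_univ_eq_zero, ← Measure.measure_univ_eq_zero,
      ← measureReal_eq_zero_iff, ← measureReal_eq_zero_iff, this]
  have hset : integrableExpSet id μ₁ = Set.univ := by
    refine Set.eq_univ_of_forall fun t => ?_
    change Integrable (fun x => Real.exp (t * id x)) μ₁
    rw [hμ₁, integrable_withDensity_iff_integrable_smul₀' hm1 (by simp)]
    simpa [ENNReal.toReal_ofReal'] using hi1 t
  have heq : μ₁ = μ₂ := by
    refine Measure.ext_of_complexMGF_id_eq (funext fun z => ?_)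
    exact eqOn_complexMGF_of_mgf' hmgf hz (by simp [hset])
  rw [hμ₁, hμ₂, withDensity_eq_iff_of_sigmaFinite hm1 hm2] at heq
  filter_upwards [heq] with x hx
  rcases le_total (h x) 0 with h' | h'
  · rw [ENNReal.ofReal_of_nonpos h', eq_comm, ENNReal.ofReal_eq_zero] at hx
    exact le_antisymm h' (show 0 ≤ h x by linarith)
  · rw [ENNReal.ofReal_of_nonpos (p := -h x) (by linarith), ENNReal.ofReal_eq_zero] at hx
    exact le_antisymm hx h'

theorem inner_toLp_eq_integral {Ω : Type*} [MeasurableSpace Ω] {P : Measure Ω} {f g : Ω → ℝ}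
    (hf : MemLp f 2 P) (hg : MemLp g 2 P) :
    inner ℝ (hf.toLp f) (hg.toLp g) = ∫ ω, f ω * g ω ∂P := by
  rw [L2.inner_def]
  refine integral_congr_ae ?_
  filter_upwards [hf.coeFn_toLp, hg.coeFn_toLp] with ω h1 h2
  simp [h1, h2, mul_comm]

theorem topologicalClosure_span_exp_eq_top {ν : Measure ℝ} [IsFiniteMeasure ν]
    (hν : ∀ t, MemLp (fun x => Real.exp (t * x)) 2 ν) :
    (Submodule.span ℝ (Set.range fun t => (hν t).toLp)).topologicalClosure = ⊤ := by
  rw [Submodule.topologicalClosure_eq_top_iff, Submodule.eq_bot_iff]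
  intro x hx
  rw [Submodule.mem_orthogonal] at hx
  rw [Lp.eq_zero_iff_ae_eq_zero]
  refine ae_eq_zero_of_integral_exp_mul_eq_zero (fun t => (hν t).integrable (by norm_num))
    (Lp.memLp x) fun t => ?_
  have := hx _ (Submodule.subset_span ⟨t, rfl⟩)
  rwa [← Lp.toLp_coeFn x (Lp.memLp x), inner_toLp_eq_integral] at this

/-! ### Gebelein's inequality -/

open scoped InnerProductSpace in
/-- Cauchy–Schwarz for a vector `F` orthogonal to the unit vector `e`. -/
theorem inner_sq_le_of_inner_eq_zero {H : Type*} [NormedAddCommGroup H] [InnerProductSpace ℝ H]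
    {F e : H} (he : ⟪e, e⟫_ℝ = 1) (hF : ⟪F, e⟫_ℝ = 0) (x : H) :
    ⟪F, x⟫_ℝ ^ 2 ≤ ⟪F, F⟫_ℝ * (⟪x, x⟫_ℝ - ⟪e, x⟫_ℝ ^ 2) := by
  have h1 : ⟪F, x - ⟪e, x⟫_ℝ • e⟫_ℝ = ⟪F, x⟫_ℝ := by
    rw [inner_sub_right, inner_smul_right, hF, mul_zero, sub_zero]
  have h2 : ⟪x - ⟪e, x⟫_ℝ • e, x - ⟪e, x⟫_ℝ • e⟫_ℝ = ⟪x, x⟫_ℝ - ⟪e, x⟫_ℝ ^ 2 := by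
    simp only [inner_sub_left, inner_sub_right, real_inner_smul_left, real_inner_smul_right, he,
      real_inner_comm e x]
    ring
  rw [← h1, ← h2, sq]
  exact real_inner_mul_inner_self_le _ _

open scoped InnerProductSpace in
/-- The Hilbert space form of Gebelein's inequality on finite combinations of exponentials. Here `e`
is the constant function `1`, `F` is a function of `X`, and `y t`, `x t` are the exponentials
`exp (t Y)`, `exp (t U)`, where `Y` is the sum of `U`, a function of `X`, and independent noise with
moment generating function `M`. The projection of `y t` on the functions of `X` is `M t • x t`. The
hypotheses `hyy` and `hxx` say that, up to the normalization `D`, the Gram matrices of the `y t` and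
of these projections are `exp (v s t)` and `exp (θ v s t)`. -/
theorem inner_sum_smul_sq_le {H : Type*} [NormedAddCommGroup H] [InnerProductSpace ℝ H]
    {F e : H} (he : ⟪e, e⟫_ℝ = 1) (hF : ⟪F, e⟫_ℝ = 0) {y x : ℝ → H} {M D : ℝ → ℝ} {θ v : ℝ}
    (hθ₀ : 0 ≤ θ) (hθ₁ : θ ≤ 1) (hv : 0 ≤ v)
    (hFy : ∀ t, ⟪F, y t⟫_ℝ = M t * ⟪F, x t⟫_ℝ)
    (hey : ∀ t, ⟪e, y t⟫_ℝ = D t) (hex : ∀ t, M t * ⟪e, x t⟫_ℝ = D t)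
    (hyy : ∀ s t, ⟪y s, y t⟫_ℝ = D s * D t * Real.exp (v * (s * t)))
    (hxx : ∀ s t, M s * M t * ⟪x s, x t⟫_ℝ = D s * D t * Real.exp (θ * v * (s * t)))
    (S : Finset ℝ) (c : ℝ → ℝ) :
    ⟪F, ∑ t ∈ S, c t • y t⟫_ℝ ^ 2 ≤ θ * ⟪F, F⟫_ℝ *
      (⟪∑ t ∈ S, c t • y t, ∑ t ∈ S, c t • y t⟫_ℝ - ⟪e, ∑ t ∈ S, c t • y t⟫_ℝ ^ 2) := by
  have h1 : ⟪F, ∑ t ∈ S, c t • y t⟫_ℝ = ⟪F, ∑ t ∈ S, (c t * M t) • x t⟫_ℝ := by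
    simp only [inner_sum, inner_smul_right, hFy, mul_assoc]
  have h2 : ⟪e, ∑ t ∈ S, c t • y t⟫_ℝ = ∑ t ∈ S, c t * D t := by
    simp only [inner_sum, inner_smul_right, hey]
  have h3 : ⟪e, ∑ t ∈ S, (c t * M t) • x t⟫_ℝ = ∑ t ∈ S, c t * D t := by
    simp only [inner_sum, inner_smul_right, mul_assoc, hex]
  have h4 : ⟪∑ t ∈ S, c t • y t, ∑ t ∈ S, c t • y t⟫_ℝ =
      ∑ s ∈ S, ∑ t ∈ S, (c s * D s) * (c t * D t) * Real.exp (v * (s * t)) := by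
    simp only [sum_inner, inner_sum, real_inner_smul_left, real_inner_smul_right, hyy]
    refine Finset.sum_congr rfl fun s _ => Finset.sum_congr rfl fun t _ => ?_
    rw [mul_comm t s]
    ring
  have h5 : ⟪∑ t ∈ S, (c t * M t) • x t, ∑ t ∈ S, (c t * M t) • x t⟫_ℝ =
      ∑ s ∈ S, ∑ t ∈ S, (c s * D s) * (c t * D t) * Real.exp (θ * v * (s * t)) := by
    simp only [sum_inner, inner_sum, real_inner_smul_left, real_inner_smul_right]
    refine Finset.sum_congr rfl fun s _ => Finset.sum_congr rfl fun t _ => ?_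
    linear_combination c s * c t * hxx s t + c s * M s * c t * M t * real_inner_comm (x s) (x t)
  have h6 := gram_exp_le S (fun t => c t * D t) id hθ₀ hθ₁ hv
  simp only [id] at h6
  have h7 := inner_sq_le_of_inner_eq_zero he hF (∑ t ∈ S, (c t * M t) • x t)
  rw [h3, h5] at h7
  rw [h1, h2, h4]
  refine h7.trans ?_
  rw [mul_comm θ ⟪F, F⟫_ℝ, mul_assoc]
  refine mul_le_mul_of_nonneg_left ?_ real_inner_self_nonneg
  linarith

/-- Gebelein's inequality: if `Y = φ(X) + ε` with `ε` independent of `X` and both summands Gaussian,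
of variances `u = θ (u + w)` and `w`, then `𝔼[f(X) g(Y)]² ≤ θ 𝔼[f(X)²] Var(g(Y))` for centred
`f(X)`. Both sides are continuous in `g ∈ L²`, so exponential sums `g` suffice. -/
theorem sq_integral_mul_le_of_indepFun_gaussianReal {Ω E : Type*} [MeasurableSpace Ω]
    [MeasurableSpace E] {P : Measure Ω} [IsProbabilityMeasure P] {X : Ω → E} {φ : E → ℝ}
    {ε : Ω → ℝ} (hX : Measurable X) (hφ : Measurable φ) (hε : Measurable ε) {m n : ℝ}
    {u w : NNReal} (hU : P.map (fun ω => φ (X ω)) = gaussianReal m u)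
    (hεlaw : P.map ε = gaussianReal n w) (hind : X ⟂ᵢ[P] ε) {θ : ℝ} (hθ₀ : 0 ≤ θ) (hθ₁ : θ ≤ 1)
    (hθ : (u : ℝ) = θ * (u + w)) {f : E → ℝ} {g : ℝ → ℝ} (hf : Measurable f) (hg : Measurable g)
    (hfL : MemLp (fun ω => f (X ω)) 2 P) (hgL : MemLp (fun ω => g (φ (X ω) + ε ω)) 2 P)
    (hf0 : ∫ ω, f (X ω) ∂P = 0) :
    (∫ ω, f (X ω) * g (φ (X ω) + ε ω) ∂P) ^ 2 ≤ θ * (∫ ω, f (X ω) * f (X ω) ∂P) *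
      (∫ ω, g (φ (X ω) + ε ω) * g (φ (X ω) + ε ω) ∂P - (∫ ω, g (φ (X ω) + ε ω) ∂P) ^ 2) := by
  set U : Ω → ℝ := fun ω => φ (X ω) with hUdef
  set Y : Ω → ℝ := fun ω => φ (X ω) + ε ω with hYdef
  have hUm : Measurable U := hφ.comp hX
  have hYm : Measurable Y := hUm.add hε
  have hUε : U ⟂ᵢ[P] ε := hind.comp hφ measurable_id
  have hYlaw : P.map Y = gaussianReal (m + n) (u + w) :=
    gaussianReal_add_gaussianReal_of_indepFun hUε hU hεlaw
  have hmp : MeasurePreserving Y P (gaussianReal (m + n) (u + w)) := ⟨hYm, hYlaw⟩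
  have iU (t : ℝ) : Integrable (fun ω => Real.exp (t * U ω)) P := by
    rw [← mgf_pos_iff, mgf_gaussianReal hU]; positivity
  have iY (t : ℝ) : Integrable (fun ω => Real.exp (t * Y ω)) P := by
    rw [← mgf_pos_iff, mgf_gaussianReal hYlaw]; positivity
  have eU (t : ℝ) := memLp_two_exp_mul hUm.aemeasurable (iU (2 * t))
  have eY (t : ℝ) := memLp_two_exp_mul hYm.aemeasurable (iY (2 * t))
  have eν (t : ℝ) : MemLp (fun x => Real.exp (t * x)) 2 (gaussianReal (m + n) (u + w)) :=
    memLp_two_exp_mul aemeasurable_id (integrable_exp_mul_gaussianReal _)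
  have e1 : MemLp (fun _ : Ω => (1 : ℝ)) 2 P := memLp_const 1
  -- averaging over the independent noise replaces `exp (t * Y)` by a multiple of `exp (t * U)`
  have hmul (h : E → ℝ) (hh : Measurable h) (t : ℝ) :
      ∫ ω, h (X ω) * Real.exp (t * Y ω) ∂P =
        Real.exp (n * t + w * t ^ 2 / 2) * ∫ ω, h (X ω) * Real.exp (t * U ω) ∂P := by
    have hi : (fun ω => h (X ω) * Real.exp (t * U ω)) ⟂ᵢ[P] (fun ω => Real.exp (t * ε ω)) :=
      hind.comp (φ := fun z => h z * Real.exp (t * φ z)) (ψ := fun z => Real.exp (t * z))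
        (by fun_prop) (by fun_prop)
    have := hi.integral_fun_mul_eq_mul_integral (by fun_prop) (by fun_prop)
    rw [show ∫ ω, Real.exp (t * ε ω) ∂P = Real.exp (n * t + w * t ^ 2 / 2) from
      mgf_gaussianReal hεlaw t] at this
    rw [mul_comm, ← this]
    refine integral_congr_ae (.of_forall fun ω => ?_)
    simp only [hYdef, hUdef]
    rw [mul_add t, Real.exp_add, mul_assoc]
  have expU (t : ℝ) : ∫ ω, Real.exp (t * U ω) ∂P = Real.exp (m * t + u * t ^ 2 / 2) :=
    mgf_gaussianReal hU t
  have expY (t : ℝ) : ∫ ω, Real.exp (t * Y ω) ∂P =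
      Real.exp ((m + n) * t + (u + w) * t ^ 2 / 2) := by
    have := mgf_gaussianReal hYlaw t
    rwa [NNReal.coe_add] at this
  let W := Lp.compMeasurePreservingₗᵢ ℝ (E := ℝ) (p := 2) Y hmp
  have hWexp (t : ℝ) : W (eν t).toLp = (eY t).toLp := Lp.toLp_compMeasurePreserving (eν t) hmp
  have key : ∀ x, inner ℝ hfL.toLp (W x) ^ 2 ≤ θ * inner ℝ hfL.toLp hfL.toLp *
      (inner ℝ (W x) (W x) - inner ℝ e1.toLp (W x) ^ 2) := by
    intro x
    have hcl : IsClosed {x | inner ℝ hfL.toLp (W x) ^ 2 ≤ θ * inner ℝ hfL.toLp hfL.toLp *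
        (inner ℝ (W x) (W x) - inner ℝ e1.toLp (W x) ^ 2)} := by
      have := W.continuous
      exact isClosed_le (by fun_prop) (by fun_prop)
    have hx : x ∈ (Submodule.span ℝ (Set.range fun t => (eν t).toLp)).topologicalClosure := by
      rw [topologicalClosure_span_exp_eq_top eν]
      trivial
    refine closure_minimal ?_ hcl hx
    intro z hz
    obtain ⟨c, rfl⟩ := Finsupp.mem_span_range_iff_exists_finsupp.1 hz
    have := inner_sum_smul_sq_le (F := hfL.toLp) (e := e1.toLp) (y := fun t => (eY t).toLp)
      (x := fun t => (eU t).toLp) (M := fun t => Real.exp (n * t + w * t ^ 2 / 2))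
      (D := fun t => Real.exp ((m + n) * t + (u + w) * t ^ 2 / 2)) (θ := θ) (v := u + w)
      ?_ ?_ hθ₀ hθ₁ (by positivity) ?_ ?_ ?_ ?_ ?_ c.support c
    · simpa only [Set.mem_ofPred_eq, Finsupp.sum, map_sum, map_smul, hWexp] using this
    · rw [inner_toLp_eq_integral]
      simp
    · rw [inner_toLp_eq_integral]
      simpa using hf0
    · intro t
      rw [inner_toLp_eq_integral, inner_toLp_eq_integral]
      exact hmul f hf t
    · intro t
      simp only [inner_toLp_eq_integral, one_mul, expY]
    · intro t
      simp only [inner_toLp_eq_integral, one_mul, expU, ← Real.exp_add]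
      ring_nf
    · intro s t
      simp only [inner_toLp_eq_integral, ← Real.exp_add, ← add_mul, expY]
      ring_nf
    · intro s t
      simp only [inner_toLp_eq_integral, ← Real.exp_add, ← add_mul, expU]
      rw [← hθ]
      ring_nf
  have gν : MemLp g 2 (gaussianReal (m + n) (u + w)) := by
    rw [← hYlaw, memLp_map_measure_iff hg.aestronglyMeasurable hYm.aemeasurable]
    exact hgL
  have hWg : W gν.toLp = hgL.toLp := Lp.toLp_compMeasurePreserving gν hmp
  have := key gν.toLp
  rw [hWg] at this
  simpa only [inner_toLp_eq_integral, one_mul] using this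

/-! ### Maximal correlation of a general pair -/

theorem le_hgrCorrelation {α β : Type*} [MeasurableSpace α] [MeasurableSpace β]
    {P : Measure (α × β)} {r : ℝ} (hr : r ∈ hgrValues P) : r ≤ hgrCorrelation P :=
  le_csSup ⟨1, fun _ => le_one_of_mem_hgrValues P⟩ hr

theorem hgrCorrelation_nonneg {α β : Type*} [MeasurableSpace α] [MeasurableSpace β]
    (P : Measure (α × β)) : 0 ≤ hgrCorrelation P := by
  rcases (hgrValues P).eq_empty_or_nonempty with h | ⟨r, hr⟩
  · simp [hgrCorrelation, h]
  · have hneg : -r ∈ hgrValues P := by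
      obtain ⟨f, g, hf, hg, hf0, hg0, hf2, hg2, rfl⟩ := hr
      refine ⟨fun x => -f x, g, hf.neg, hg, ?_, hg0, ?_, hg2, ?_⟩
      · rw [integral_neg, hf0, neg_zero]
      · simpa using hf2
      · simp only [neg_mul, integral_neg]
    have h1 := le_hgrCorrelation hr
    have h2 := le_hgrCorrelation hneg
    linarith

/-- The correlation of two square integrable functions of `X` and `Y` bounds the maximal
correlation from below. -/
theorem covariance_div_le_hgrCorrelation {α β : Type*} [MeasurableSpace α] [MeasurableSpace β]
    {P : Measure (α × β)} [IsProbabilityMeasure P] {f : α → ℝ} {g : β → ℝ} (hf : Measurable f)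
    (hg : Measurable g) (hfL : MemLp (fun z => f z.1) 2 P) (hgL : MemLp (fun z => g z.2) 2 P)
    (hfv : 0 < Var[fun z => f z.1; P]) (hgv : 0 < Var[fun z => g z.2; P]) :
    cov[fun z => f z.1, fun z => g z.2; P] /
      (Real.sqrt Var[fun z => f z.1; P] * Real.sqrt Var[fun z => g z.2; P]) ≤
      hgrCorrelation P := by
  have hfi := hfL.integrable (by norm_num)
  have hgi := hgL.integrable (by norm_num)
  have hvf := variance_eq_integral hfL.aestronglyMeasurable.aemeasurable
  have hvg := variance_eq_integral hgL.aestronglyMeasurable.aemeasurable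
  refine le_hgrCorrelation ⟨fun x => (f x - ∫ z, f z.1 ∂P) / Real.sqrt Var[fun z => f z.1; P],
    fun y => (g y - ∫ z, g z.2 ∂P) / Real.sqrt Var[fun z => g z.2; P], by fun_prop, by fun_prop,
    ?_, ?_, ?_, ?_, ?_⟩
  · rw [integral_div, integral_sub hfi (integrable_const _)]
    simp
  · rw [integral_div, integral_sub hgi (integrable_const _)]
    simp
  · simp only [div_pow, Real.sq_sqrt hfv.le]
    rw [integral_div, ← hvf, div_self hfv.ne']
  · simp only [div_pow, Real.sq_sqrt hgv.le]
    rw [integral_div, ← hvg, div_self hgv.ne']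
  · simp only [div_mul_div_comm]
    rw [integral_div, covariance]

/-! ### Linear regression -/

theorem memLp_dotProduct {p : ℕ} {P : Measure ((Fin p → ℝ) × ℝ)}
    (hX : ∀ i, MemLp (fun z : (Fin p → ℝ) × ℝ => z.1 i) 2 P) (a : Fin p → ℝ) :
    MemLp (fun z : (Fin p → ℝ) × ℝ => a ⬝ᵥ z.1) 2 P := by
  simp only [dotProduct]
  exact memLp_finsetSum _ fun i _ => (hX i).const_mul (a i)

theorem IsRegressionVector.covariance_dotProduct_eq_zero {p : ℕ} {P : Measure ((Fin p → ℝ) × ℝ)}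
    [IsProbabilityMeasure P] (hX : ∀ i, MemLp (fun z : (Fin p → ℝ) × ℝ => z.1 i) 2 P)
    (hY : MemLp (fun z : (Fin p → ℝ) × ℝ => z.2) 2 P) {a : Fin p → ℝ}
    (ha : IsRegressionVector P a) (b : Fin p → ℝ) :
    cov[fun z : (Fin p → ℝ) × ℝ => z.2 - a ⬝ᵥ z.1, fun z => b ⬝ᵥ z.1; P] = 0 := by
  have hR : MemLp (fun z : (Fin p → ℝ) × ℝ => z.2 - a ⬝ᵥ z.1) 2 P :=
    hY.sub (memLp_dotProduct hX a)
  simp only [dotProduct] at hR ⊢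
  rw [covariance_fun_sum_right (fun i => (hX i).const_mul (b i)) hR]
  refine Finset.sum_eq_zero fun i _ => ?_
  rw [covariance_const_mul_right]
  exact mul_eq_zero_of_right _ (ha i)

theorem IsRegressionVector.covariance_dotProduct {p : ℕ} {P : Measure ((Fin p → ℝ) × ℝ)}
    [IsProbabilityMeasure P] (hX : ∀ i, MemLp (fun z : (Fin p → ℝ) × ℝ => z.1 i) 2 P)
    (hY : MemLp (fun z : (Fin p → ℝ) × ℝ => z.2) 2 P) {a : Fin p → ℝ}
    (ha : IsRegressionVector P a) :
    cov[fun z : (Fin p → ℝ) × ℝ => a ⬝ᵥ z.1, fun z => z.2; P] =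
      Var[fun z : (Fin p → ℝ) × ℝ => a ⬝ᵥ z.1; P] := by
  have hU := memLp_dotProduct hX a
  have h := ha.covariance_dotProduct_eq_zero hX hY a
  rw [covariance_fun_sub_left hY hU hU, covariance_self hU.aestronglyMeasurable.aemeasurable,
    sub_eq_zero] at h
  rw [covariance_comm, h]

theorem IsRegressionVector.variance_snd {p : ℕ} {P : Measure ((Fin p → ℝ) × ℝ)}
    [IsProbabilityMeasure P] (hX : ∀ i, MemLp (fun z : (Fin p → ℝ) × ℝ => z.1 i) 2 P)
    (hY : MemLp (fun z : (Fin p → ℝ) × ℝ => z.2) 2 P) {a : Fin p → ℝ}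
    (ha : IsRegressionVector P a) :
    Var[fun z : (Fin p → ℝ) × ℝ => z.2; P] = Var[fun z : (Fin p → ℝ) × ℝ => a ⬝ᵥ z.1; P] +
      Var[fun z : (Fin p → ℝ) × ℝ => z.2 - a ⬝ᵥ z.1; P] := by
  have hU := memLp_dotProduct hX a
  rw [variance_fun_sub hY hU, covariance_comm, ha.covariance_dotProduct hX hY]
  ring

/-- The lower bound: the fitted value `aᵀX` and `Y` have correlation `√(Var(aᵀX) / Var(Y))`. If one
of the two variances vanishes, so does the left side (for `Var(Y) = 0` because `x / 0 = 0`). -/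
theorem IsRegressionVector.sqrt_le_hgrCorrelation {p : ℕ} {P : Measure ((Fin p → ℝ) × ℝ)}
    [IsProbabilityMeasure P] (hX : ∀ i, MemLp (fun z : (Fin p → ℝ) × ℝ => z.1 i) 2 P)
    (hY : MemLp (fun z : (Fin p → ℝ) × ℝ => z.2) 2 P) {a : Fin p → ℝ}
    (ha : IsRegressionVector P a) :
    Real.sqrt (Var[fun z : (Fin p → ℝ) × ℝ => a ⬝ᵥ z.1; P] /
      Var[fun z : (Fin p → ℝ) × ℝ => z.2; P]) ≤ hgrCorrelation P := by
  have hU := memLp_dotProduct hX a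
  rcases (variance_nonneg (fun z : (Fin p → ℝ) × ℝ => a ⬝ᵥ z.1) P).eq_or_lt with h | h
  · rw [← h, zero_div, Real.sqrt_zero]
    exact hgrCorrelation_nonneg P
  · have hv : 0 < Var[fun z : (Fin p → ℝ) × ℝ => z.2; P] := by
      rw [ha.variance_snd hX hY]
      exact add_pos_of_pos_of_nonneg h (variance_nonneg _ _)
    have := covariance_div_le_hgrCorrelation (f := fun x : Fin p → ℝ => a ⬝ᵥ x) (g := id)
      (by fun_prop) measurable_id hU hY h hv
    simp only [id] at this
    rw [ha.covariance_dotProduct hX hY, div_mul_eq_div_div, Real.div_sqrt] at this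
    rwa [Real.sqrt_div h.le]

/-- A regression vector consists of the coefficients of the orthogonal projection, in `L²(P)`, of
the centred `Y` on the span of the centred `Xᵢ`. -/
theorem exists_isRegressionVector {p : ℕ} {P : Measure ((Fin p → ℝ) × ℝ)}
    [IsProbabilityMeasure P] (hX : ∀ i, MemLp (fun z : (Fin p → ℝ) × ℝ => z.1 i) 2 P)
    (hY : MemLp (fun z : (Fin p → ℝ) × ℝ => z.2) 2 P) : ∃ a, IsRegressionVector P a := by
  have hXc (i : Fin p) : MemLp (fun z : (Fin p → ℝ) × ℝ => z.1 i - ∫ w, w.1 i ∂P) 2 P :=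
    (hX i).sub (memLp_const _)
  have hYc : MemLp (fun z : (Fin p → ℝ) × ℝ => z.2 - ∫ w, w.2 ∂P) 2 P := hY.sub (memLp_const _)
  let K := Submodule.span ℝ (Set.range fun i => (hXc i).toLp)
  have : FiniteDimensional ℝ K := FiniteDimensional.span_of_finite ℝ (Set.finite_range _)
  obtain ⟨a, ha⟩ := (Submodule.mem_span_range_iff_exists_fun ℝ).1
    (K.starProjection_apply_mem hYc.toLp)
  refine ⟨a, fun i => ?_⟩
  have horth := K.sub_starProjection_mem_orthogonal hYc.toLp
  rw [Submodule.mem_orthogonal] at horth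
  have h0 := horth _ (Submodule.subset_span ⟨i, rfl⟩)
  rw [← ha, inner_sub_right, inner_sum] at h0
  simp only [real_inner_smul_right, inner_toLp_eq_integral] at h0
  simp only [dotProduct]
  rw [covariance_fun_sub_left hY (memLp_finsetSum _ fun j _ => (hX j).const_mul (a j)) (hX i),
    covariance_fun_sum_left (fun j => (hX j).const_mul (a j)) (hX i), covariance_comm]
  simp only [covariance_const_mul_left]
  simp_rw [covariance_comm (fun z : (Fin p → ℝ) × ℝ => z.1 _) (fun z => z.1 i)]
  exact h0

/-! ### The value for Gaussian pairs -/

theorem strongDual_apply_eq_dotProduct {p : ℕ} (L : StrongDual ℝ (Fin p → ℝ)) (x : Fin p → ℝ) :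
    L x = (fun i => L (Pi.single i 1)) ⬝ᵥ x := by
  conv_lhs => rw [pi_eq_sum_univ' x]
  simp only [map_sum, map_smul, dotProduct, smul_eq_mul]
  refine Finset.sum_congr rfl fun i _ => ?_
  rw [mul_comm]

/-- The upper bound: for a Gaussian pair the residual `Y - aᵀX`, being uncorrelated with `X`, is
independent of `X`, so `Y` is a function of `X` plus independent Gaussian noise. -/
theorem IsRegressionVector.hgrCorrelation_le_of_isGaussian {p : ℕ} {P : Measure ((Fin p → ℝ) × ℝ)}
    [IsGaussian P] {a : Fin p → ℝ} (ha : IsRegressionVector P a) :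
    hgrCorrelation P ≤ Real.sqrt (Var[fun z : (Fin p → ℝ) × ℝ => a ⬝ᵥ z.1; P] /
      Var[fun z : (Fin p → ℝ) × ℝ => z.2; P]) := by
  have hid : HasGaussianLaw (fun z : (Fin p → ℝ) × ℝ => z) P := IsGaussian.hasGaussianLaw_id
  let φ : (Fin p → ℝ) →L[ℝ] ℝ := ∑ i, a i • ContinuousLinearMap.proj i
  have hφ (x : Fin p → ℝ) : φ x = a ⬝ᵥ x := by simp [φ, dotProduct]
  let R : (Fin p → ℝ) × ℝ →L[ℝ] ℝ := .snd ℝ _ _ - φ ∘L .fst ℝ _ _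
  have hX : HasGaussianLaw (fun z : (Fin p → ℝ) × ℝ => z.1) P := hid.map_fun (.fst ℝ _ _)
  have hXi (i : Fin p) : MemLp (fun z : (Fin p → ℝ) × ℝ => z.1 i) 2 P := (hX.eval i).memLp_two
  have hY : MemLp (fun z : (Fin p → ℝ) × ℝ => z.2) 2 P :=
    (hid.map_fun (.snd ℝ _ _)).memLp_two
  have hU : HasGaussianLaw (fun z : (Fin p → ℝ) × ℝ => a ⬝ᵥ z.1) P := by
    simpa only [hφ] using hX.map_fun φ
  have hε : HasGaussianLaw (fun z : (Fin p → ℝ) × ℝ => z.2 - a ⬝ᵥ z.1) P := by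
    simpa [R, hφ] using hid.map_fun R
  have hXε : HasGaussianLaw (fun z : (Fin p → ℝ) × ℝ => (z.1, z.2 - a ⬝ᵥ z.1)) P := by
    simpa [R, hφ] using hid.map_fun ((ContinuousLinearMap.fst ℝ _ _).prod R)
  have hprob := hid.isProbabilityMeasure
  have hind : (fun z : (Fin p → ℝ) × ℝ => z.1) ⟂ᵢ[P] (fun z => z.2 - a ⬝ᵥ z.1) := by
    refine hXε.indepFun_of_covariance_strongDual fun L₁ L₂ => ?_
    have h2 (y : ℝ) : L₂ y = L₂ 1 * y := by
      rw [mul_comm, ← smul_eq_mul, ← map_smul, smul_eq_mul, mul_one]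
    rw [show L₁ ∘ (fun z : (Fin p → ℝ) × ℝ => z.1) =
        fun z => (fun i => L₁ (Pi.single i 1)) ⬝ᵥ z.1 from
        funext fun z => strongDual_apply_eq_dotProduct L₁ _,
      show L₂ ∘ (fun z : (Fin p → ℝ) × ℝ => z.2 - a ⬝ᵥ z.1) =
        fun z => L₂ 1 * (z.2 - a ⬝ᵥ z.1) from funext fun z => h2 _,
      covariance_const_mul_right, covariance_comm, ha.covariance_dotProduct_eq_zero hXi hY,
      mul_zero]
  set u := Var[fun z : (Fin p → ℝ) × ℝ => a ⬝ᵥ z.1; P] with hu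
  set w := Var[fun z : (Fin p → ℝ) × ℝ => z.2 - a ⬝ᵥ z.1; P] with hw
  have hu0 : 0 ≤ u := variance_nonneg _ _
  have hw0 : 0 ≤ w := variance_nonneg _ _
  have hv := ha.variance_snd hXi hY
  rw [hv]
  refine Real.sSup_le ?_ (Real.sqrt_nonneg _)
  rintro r ⟨f, g, hf, hg, hf0, hg0, hf2, hg2, rfl⟩
  have hfL : MemLp (fun z : (Fin p → ℝ) × ℝ => f z.1) 2 P :=
    (memLp_two_iff_integrable_sq (hf.comp measurable_fst).aestronglyMeasurable).2
      (.of_integral_ne_zero (by simp [hf2]))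
  have hgL : MemLp (fun z : (Fin p → ℝ) × ℝ => g z.2) 2 P :=
    (memLp_two_iff_integrable_sq (hg.comp measurable_snd).aestronglyMeasurable).2
      (.of_integral_ne_zero (by simp [hg2]))
  have key := sq_integral_mul_le_of_indepFun_gaussianReal (X := fun z : (Fin p → ℝ) × ℝ => z.1)
    (φ := fun x => a ⬝ᵥ x) measurable_fst (by fun_prop) (by fun_prop) hU.map_eq_gaussianReal
    hε.map_eq_gaussianReal hind (θ := u / (u + w)) (by positivity)
    (div_le_one_of_le₀ (by linarith) (by positivity)) ?_ hf hg hfL (by simpa using hgL) hf0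
  · simp only [add_sub_cancel, ← sq, hf2, hg2, hg0] at key
    exact Real.le_sqrt_of_sq_le (by simpa using key)
  · rw [Real.coe_toNNReal _ (variance_nonneg _ _), Real.coe_toNNReal _ (variance_nonneg _ _),
      ← hu, ← hw]
    -- if `u + w = 0` then `u = 0`, in agreement with `u / 0 = 0`
    rcases (add_nonneg hu0 hw0).eq_or_lt with h | h
    · rw [← h, mul_zero]
      linarith
    · rw [div_mul_cancel₀ _ h.ne']

/-! ### Distributions with prescribed moments -/

theorem jointVector_castSucc {p : ℕ} (z : (Fin p → ℝ) × ℝ) (i : Fin p) :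
    jointVector z i.castSucc = z.1 i := by simp [jointVector]

theorem jointVector_last {p : ℕ} (z : (Fin p → ℝ) × ℝ) :
    jointVector z (Fin.last p) = z.2 := by simp [jointVector]

theorem dotProduct_fst_eq_dotProduct_jointVector {p : ℕ} (a : Fin p → ℝ)
    (z : (Fin p → ℝ) × ℝ) :
    a ⬝ᵥ z.1 = Fin.snoc (α := fun _ => ℝ) a 0 ⬝ᵥ jointVector z := by
  simp [dotProduct, Fin.sum_univ_castSucc, jointVector]

theorem snd_sub_dotProduct_fst_eq_dotProduct_jointVector {p : ℕ} (a : Fin p → ℝ)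
    (z : (Fin p → ℝ) × ℝ) :
    z.2 - a ⬝ᵥ z.1 = Fin.snoc (α := fun _ => ℝ) (-a) 1 ⬝ᵥ jointVector z := by
  simp only [dotProduct, Fin.sum_univ_castSucc, jointVector, Fin.snoc_castSucc, Fin.snoc_last,
    Pi.neg_apply, neg_mul, Finset.sum_neg_distrib]
  ring

theorem jointVector_apply_eq_dotProduct {p : ℕ} (i : Fin (p + 1)) (z : (Fin p → ℝ) × ℝ) :
    jointVector z i = Pi.single i 1 ⬝ᵥ jointVector z := by simp

namespace HasMoments

variable {p : ℕ} {μ : Fin (p + 1) → ℝ} {Λ : Matrix (Fin (p + 1)) (Fin (p + 1)) ℝ}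
  {P Q : Measure ((Fin p → ℝ) × ℝ)}

theorem memLp_fst (hP : HasMoments μ Λ P) (i : Fin p) :
    MemLp (fun z : (Fin p → ℝ) × ℝ => z.1 i) 2 P := by
  simpa only [jointVector_castSucc] using hP.memLp_two i.castSucc

theorem memLp_snd (hP : HasMoments μ Λ P) : MemLp (fun z : (Fin p → ℝ) × ℝ => z.2) 2 P := by
  simpa only [jointVector_last] using hP.memLp_two (Fin.last p)

theorem covariance_jointVector (hP : HasMoments μ Λ P) (i j : Fin (p + 1)) :
    cov[fun z => jointVector z i, fun z => jointVector z j; P] = Λ i j - μ i * μ j := by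
  have := hP.isProbabilityMeasure
  rw [covariance_eq_sub (hP.memLp_two i) (hP.memLp_two j), hP.first_moment, hP.first_moment,
    ← hP.second_moment]
  rfl

/-- Covariances of linear statistics depend only on the prescribed moments. -/
theorem covariance_dotProduct_jointVector (hP : HasMoments μ Λ P) (k l : Fin (p + 1) → ℝ) :
    cov[fun z => k ⬝ᵥ jointVector z, fun z => l ⬝ᵥ jointVector z; P] =
      k ⬝ᵥ (Λ - Matrix.vecMulVec μ μ).mulVec l := by
  have := hP.isProbabilityMeasure
  simp only [dotProduct, Matrix.mulVec]
  rw [covariance_fun_sum_fun_sum (fun i => (hP.memLp_two i).const_mul (k i))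
    (fun j => (hP.memLp_two j).const_mul (l j))]
  refine Finset.sum_congr rfl fun i _ => ?_
  rw [Finset.mul_sum]
  refine Finset.sum_congr rfl fun j _ => ?_
  rw [covariance_const_mul_left, covariance_const_mul_right, hP.covariance_jointVector,
    Matrix.sub_apply, Matrix.vecMulVec_apply]
  ring

theorem memLp_dotProduct_jointVector (hP : HasMoments μ Λ P) (k : Fin (p + 1) → ℝ) :
    MemLp (fun z => k ⬝ᵥ jointVector z) 2 P := by
  simp only [dotProduct]
  exact memLp_finsetSum _ fun i _ => (hP.memLp_two i).const_mul (k i)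

theorem integral_dotProduct_jointVector (hP : HasMoments μ Λ P) (k : Fin (p + 1) → ℝ) :
    ∫ z, k ⬝ᵥ jointVector z ∂P = k ⬝ᵥ μ := by
  have := hP.isProbabilityMeasure
  simp only [dotProduct]
  rw [integral_finsetSum _ fun i _ =>
    ((hP.memLp_two i).integrable (by norm_num)).const_mul (k i)]
  simp only [integral_const_mul, hP.first_moment]

theorem variance_dotProduct_jointVector (hP : HasMoments μ Λ P) (k : Fin (p + 1) → ℝ) :
    Var[fun z => k ⬝ᵥ jointVector z; P] = k ⬝ᵥ (Λ - Matrix.vecMulVec μ μ).mulVec k := by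
  rw [← hP.covariance_dotProduct_jointVector,
    covariance_self (hP.memLp_dotProduct_jointVector k).aestronglyMeasurable.aemeasurable]

theorem posSemidef (hP : HasMoments μ Λ P) : (Λ - Matrix.vecMulVec μ μ).PosSemidef := by
  refine .of_dotProduct_mulVec_nonneg ?_ fun k => ?_
  · ext i j
    simp only [Matrix.conjTranspose_apply, Matrix.sub_apply, Matrix.vecMulVec_apply, star_trivial]
    rw [← hP.covariance_jointVector, ← hP.covariance_jointVector, covariance_comm]
  · rw [star_trivial, ← hP.variance_dotProduct_jointVector]
    exact variance_nonneg _ _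

theorem variance_dotProduct_fst_eq (hP : HasMoments μ Λ P) (hQ : HasMoments μ Λ Q)
    (a : Fin p → ℝ) :
    Var[fun z : (Fin p → ℝ) × ℝ => a ⬝ᵥ z.1; P] = Var[fun z : (Fin p → ℝ) × ℝ => a ⬝ᵥ z.1; Q] := by
  simp only [dotProduct_fst_eq_dotProduct_jointVector]
  rw [hP.variance_dotProduct_jointVector, hQ.variance_dotProduct_jointVector]

theorem variance_snd_eq (hP : HasMoments μ Λ P) (hQ : HasMoments μ Λ Q) :
    Var[fun z : (Fin p → ℝ) × ℝ => z.2; P] = Var[fun z : (Fin p → ℝ) × ℝ => z.2; Q] := by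
  simp only [← jointVector_last, jointVector_apply_eq_dotProduct]
  rw [hP.variance_dotProduct_jointVector, hQ.variance_dotProduct_jointVector]

theorem isRegressionVector (hP : HasMoments μ Λ P) (hQ : HasMoments μ Λ Q) {a : Fin p → ℝ}
    (ha : IsRegressionVector P a) : IsRegressionVector Q a := by
  intro i
  rw [← ha i]
  simp only [snd_sub_dotProduct_fst_eq_dotProduct_jointVector]
  simp only [← jointVector_castSucc, jointVector_apply_eq_dotProduct i.castSucc]
  rw [hP.covariance_dotProduct_jointVector, hQ.covariance_dotProduct_jointVector]

/-- The characteristic function of a Gaussian distribution involves only the means and variances of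
linear functionals, which the prescribed moments determine. -/
theorem eq_of_isGaussian [IsGaussian P] [IsGaussian Q] (hP : HasMoments μ Λ P)
    (hQ : HasMoments μ Λ Q) : P = Q := by
  refine Measure.ext_of_charFunDual (funext fun L => ?_)
  let k : Fin (p + 1) → ℝ := Fin.snoc (α := fun _ => ℝ) (fun i => L (Pi.single i 1, 0)) (L (0, 1))
  have hL : ⇑L = fun z => k ⬝ᵥ jointVector z := by
    ext z
    have h1 : L z = L (z.1, 0) + z.2 * L (0, 1) := by
      rw [← smul_eq_mul, ← map_smul, ← map_add]
      simp
    have h2 := strongDual_apply_eq_dotProduct (L ∘L .inl ℝ _ _) z.1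
    simp only [ContinuousLinearMap.comp_apply, ContinuousLinearMap.inl_apply] at h2
    rw [h1, h2]
    simp [k, dotProduct, Fin.sum_univ_castSucc, jointVector, mul_comm]
  simp only [IsGaussian.charFunDual_eq, integral_complex_ofReal]
  rw [hL, hP.integral_dotProduct_jointVector, hQ.integral_dotProduct_jointVector,
    hP.variance_dotProduct_jointVector, hQ.variance_dotProduct_jointVector]

/-- If the prescribed moments are those of some distribution, then they are the moments of the
(possibly degenerate) Gaussian distribution with mean `μ` and covariance `Λ - μμᵀ`. -/
theorem exists_isGaussian (hP : HasMoments μ Λ P) :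
    ∃ G : Measure ((Fin p → ℝ) × ℝ), IsGaussian G ∧ HasMoments μ Λ G := by
  let S := Λ - Matrix.vecMulVec μ μ
  let N := multivariateGaussian (WithLp.toLp 2 μ) S
  let T : EuclideanSpace ℝ (Fin (p + 1)) →L[ℝ] (Fin p → ℝ) × ℝ :=
    (ContinuousLinearMap.pi fun i => EuclideanSpace.proj i.castSucc).prod
      (EuclideanSpace.proj (Fin.last p))
  have hT (x : EuclideanSpace ℝ (Fin (p + 1))) (i : Fin (p + 1)) : jointVector (T x) i = x i := by
    refine Fin.lastCases ?_ (fun j => ?_) i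
    · simp [jointVector_last, T]
    · simp [jointVector_castSucc, T]
  have hTm : Measurable T := T.continuous.measurable
  have hm (i : Fin (p + 1)) : Measurable fun z : (Fin p → ℝ) × ℝ => jointVector z i := by
    refine Fin.lastCases ?_ (fun j => ?_) i
    · simp only [jointVector_last]; fun_prop
    · simp only [jointVector_castSucc]; fun_prop
  have hN (i : Fin (p + 1)) : MemLp (fun x : EuclideanSpace ℝ (Fin (p + 1)) => x i) 2 N :=
    IsGaussian.memLp_dual N (EuclideanSpace.proj i) 2 (by simp)
  have hmean (i : Fin (p + 1)) : ∫ x, x i ∂N = μ i := by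
    have := (EuclideanSpace.proj (𝕜 := ℝ) i).integral_comp_comm
      (IsGaussian.integrable_id (μ := N))
    simpa [N] using this
  refine ⟨N.map T, inferInstance, inferInstance, fun i => ?_, fun i => ?_, fun i j => ?_⟩
  · rw [memLp_map_measure_iff (hm i).aestronglyMeasurable hTm.aemeasurable]
    simpa only [Function.comp_def, hT] using hN i
  · rw [integral_map hTm.aemeasurable (hm i).aestronglyMeasurable]
    simpa only [hT] using hmean i
  · rw [integral_map hTm.aemeasurable (by
      exact ((hm i).mul (hm j)).aestronglyMeasurable)]
    simp only [hT]
    have h := covariance_eval_multivariateGaussian (μ := WithLp.toLp 2 μ) hP.posSemidef i j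
    rw [covariance_eq_sub (hN i) (hN j), hmean, hmean, Matrix.sub_apply,
      Matrix.vecMulVec_apply] at h
    have h' : ∫ x, x i * x j ∂N - μ i * μ j = Λ i j - μ i * μ j := h
    linarith

end HasMoments

/-! ### The minimum of the maximal correlation -/

theorem theorem1 (p : ℕ) (μ : Fin (p + 1) → ℝ) (Λ : Matrix (Fin (p + 1)) (Fin (p + 1)) ℝ)
    (hfeasible : ∃ P : Measure ((Fin p → ℝ) × ℝ), HasMoments μ Λ P) :
    -- the Gaussian distribution with the given moments exists and is unique
    (∃! PG : Measure ((Fin p → ℝ) × ℝ), IsGaussian PG ∧ HasMoments μ Λ PG) ∧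
    -- a regression vector exists, determined by the given moments
    (∃ a : Fin p → ℝ, ∀ P : Measure ((Fin p → ℝ) × ℝ),
      HasMoments μ Λ P → IsRegressionVector P a) ∧
    ∀ PG : Measure ((Fin p → ℝ) × ℝ), IsGaussian PG → HasMoments μ Λ PG →
      -- the Gaussian distribution is a minimizer
      (∀ P : Measure ((Fin p → ℝ) × ℝ), HasMoments μ Λ P →
        hgrCorrelation PG ≤ hgrCorrelation P) ∧
      -- the minimum value, which is the same computed under any feasible distribution
      (∀ (P : Measure ((Fin p → ℝ) × ℝ)) (a : Fin p → ℝ), HasMoments μ Λ P →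
        IsRegressionVector P a → 0 < Var[fun z : (Fin p → ℝ) × ℝ => z.2; P] →
        hgrCorrelation PG =
          Real.sqrt (Var[fun z : (Fin p → ℝ) × ℝ => a ⬝ᵥ z.1; P] /
            Var[fun z : (Fin p → ℝ) × ℝ => z.2; P])) := by
  obtain ⟨P₀, h₀⟩ := hfeasible
  obtain ⟨G, hG, hGm⟩ := h₀.exists_isGaussian
  have := h₀.isProbabilityMeasure
  obtain ⟨a, ha⟩ := exists_isRegressionVector h₀.memLp_fst h₀.memLp_snd
  have lower {P : Measure ((Fin p → ℝ) × ℝ)} (hP : HasMoments μ Λ P) {b : Fin p → ℝ}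
      (hb : IsRegressionVector P b) := by
    have := hP.isProbabilityMeasure
    exact hb.sqrt_le_hgrCorrelation hP.memLp_fst hP.memLp_snd
  refine ⟨⟨G, ⟨hG, hGm⟩, ?_⟩, ⟨a, fun P hP => h₀.isRegressionVector hP ha⟩, ?_⟩
  · rintro Q ⟨hQ, hQm⟩
    exact hQm.eq_of_isGaussian hGm
  · intro PG hPG hPGm
    refine ⟨fun P hP => ?_, fun P b hP hb _ => ?_⟩
    · have hle := (h₀.isRegressionVector hPGm ha).hgrCorrelation_le_of_isGaussian
      rw [hPGm.variance_dotProduct_fst_eq hP, hPGm.variance_snd_eq hP] at hle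
      exact hle.trans (lower hP (h₀.isRegressionVector hP ha))
    · have hbG := hP.isRegressionVector hPGm hb
      rw [hP.variance_dotProduct_fst_eq hPGm, hP.variance_snd_eq hPGm]
      exact le_antisymm hbG.hgrCorrelation_le_of_isGaussian (lower hPGm hbG)
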